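/- Let $S$ be a Hausdorff semitopological semigroup (multiplication is separately continuous), and let $C(S)$ be the $C^*$-algebra of bounded continuous functions $f:S\to\mathbb{C}$. For $s\in S$ put $(L_sf)(t)=f(st)$ and $(R_sf)(t)=f(ts)$. Let $\mathcal{WAP}(S)$ be the set of all $f\in C(S)$ such that $\{R_sf : s\in S\}$ is relatively weakly compact in $C(S)$. Let $\mathcal{F}$ be an $m$-admissible subalgebra of $C(S)$: a closed $*$-subalgebra containing the constants, invariant under all $L_s$ and $R_s$, such that for every $\mu$ in the spectrum $\Delta$ of $\mathcal{F}$ and every $f\in\mathcal{F}$ the function $(T_\mu f)(s)=\mu(L_sf)$ belongs to $\mathcal{F}$. Equip $\Delta$ with the multiplication $(\mu\nu)(f)=\mu(T_\nu f)$. An $\mathcal{F}$-filter is a proper filter $\varphi$ on $S$ such that for every $A\in\varphi$ with $A\ne S$ there are $B\in\varphi$ and $f\in\mathcal{F}$ with $f=0$ on $B$ and $f=1$ on $S\setminus A$; an $\mathcal{F}$-ultrafilter is a maximal $\mathcal{F}$-filter. Let $\delta S$ be the set of all $\mathcal{F}$-ultrafilters, with the topology having as a base the sets $\widehat{A}=\{p\in\delta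 S : A\in p\}$, $A\subseteq S$. For $s\in S$ let $\varepsilon(s)\in\delta S$ be the filter of neighbourhoods of $s$ in the weak topology on $S$ generated by $\mathcal{F}$. For a closed proper ideal $I$ of $\mathcal{F}$ let $\mathcal{B}(I)$ be the filter base of all sets $\{s\in S : |f(s)|\le r\}$ with $f\in I$ and $r>0$. The map sending $\mu\in\Delta$ to the filter generated by $\mathcal{B}(\ker\mu)$ is a bijection $\Delta\to\delta S$, and $\delta S$ carries the semigroup operation transported from $\Delta$ along it. For an $\mathcal{F}$-filter $\varphi$ put $\overline{\varphi}=\bigcap_{A\in\varphi}\overline{\varepsilon(A)}$ (closures in $\delta S$). **Theorem.** Suppose that $\mathcal{F}\subseteq\mathcal{WAP}(S)$. Let $\varphi$ be an $\mathcal{F}$-filter on $S$, and let $I$ be the closed proper ideal of $\mathcal{F}$ such that $\varphi$ is generated by $\mathcal{B}(I)$. The following statements are equivalent: 1. $\overline{\varphi}$ is a right ideal of $\delta S$ (that is, it is non-empty and $pq\in\overline{\varphi}$ for all $p\in\overline{\varphi}$ and $q\in\delta S$); 2. $I$ is right translation invariant, that is, $R_sf\in I$ for all $f\in I$ and $s\in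 S$; 3. $\varphi$ is right thick, that is, for every $A\in\varphi$ and $s\in S$ there is $B\in\varphi$ with $Bs\subseteq A$. -/

import Mathlib

open Set Filter Topology WeakDual
open scoped BoundedContinuousFunction

noncomputable section

namespace FilterCompactification

variable {S : Type*} [Semigroup S] [TopologicalSpace S] [SeparatelyContinuousMul S]

/-- The left translate `L_s f = f ∘ λ_s`, that is, `(L_s f)(t) = f (s t)`. -/
def leftTranslate (s : S) (f : S →ᵇ ℂ) : S →ᵇ ℂ :=
  f.compContinuous ⟨fun t => s * t, continuous_const_mul s⟩

/-- The right translate `R_s f = f ∘ ρ_s`, that is, `(R_s f)(t) = f (t s)`. -/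
def rightTranslate (s : S) (f : S →ᵇ ℂ) : S →ᵇ ℂ :=
  f.compContinuous ⟨fun t => t * s, continuous_mul_const s⟩

/-- `WAP(S)`: the bounded continuous functions `f` on `S` for which the set of right translates
`{R_s f : s ∈ S}` is relatively weakly compact in the Banach space of bounded continuous
functions on `S`. -/
def WAP (S : Type*) [Semigroup S] [TopologicalSpace S] [SeparatelyContinuousMul S] :
    Set (S →ᵇ ℂ) :=
  {f | IsCompact (closure (range fun s : S => toWeakSpace ℂ (S →ᵇ ℂ) (rightTranslate s f)))}

/-- An m-admissible subalgebra of the algebra of bounded continuous functions on `S`: a closed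
unital star subalgebra (so it contains the constants) that is translation invariant and that
contains the function `T_μ f : s ↦ μ (L_s f)` for all its members `f` and all points `μ` of its
spectrum. -/
structure MAdmissibleSubalgebra (S : Type*) [Semigroup S] [TopologicalSpace S]
    [SeparatelyContinuousMul S] where
  /-- The underlying unital star subalgebra. -/
  alg : StarSubalgebra ℂ (S →ᵇ ℂ)
  isClosed_alg : IsClosed (alg : Set (S →ᵇ ℂ))
  leftTranslate_mem : ∀ (s : S) (f : S →ᵇ ℂ), f ∈ alg → leftTranslate s f ∈ alg
  rightTranslate_mem : ∀ (s : S) (f : S →ᵇ ℂ), f ∈ alg → rightTranslate s f ∈ alg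
  exists_introversion : ∀ (μ : characterSpace ℂ alg) (f : alg),
    ∃ g : alg, ∀ s : S, (g : S →ᵇ ℂ) s = μ ⟨leftTranslate s f, leftTranslate_mem s f f.2⟩

namespace MAdmissibleSubalgebra

variable (F : MAdmissibleSubalgebra S)

instance : IsClosed (F.alg : Set (S →ᵇ ℂ)) := F.isClosed_alg

/-- The spectrum `Δ` of `F`, with the weak-star topology. -/
abbrev Spectrum : Type _ := characterSpace ℂ F.alg

/-- `L_s` as a map from `F` to `F`. -/
def L (s : S) (f : F.alg) : F.alg := ⟨leftTranslate s f, F.leftTranslate_mem s f f.2⟩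

/-- `R_s` as a map from `F` to `F`. -/
def R (s : S) (f : F.alg) : F.alg := ⟨rightTranslate s f, F.rightTranslate_mem s f f.2⟩

/-- The value of a member of `F` at a point, as an algebra homomorphism. -/
def evalHom (s : S) : F.alg →ₐ[ℂ] ℂ where
  toFun f := (f : S →ᵇ ℂ) s
  map_one' := rfl
  map_mul' _ _ := rfl
  map_zero' := rfl
  map_add' _ _ := rfl
  commutes' _ := by simp [Algebra.algebraMap_eq_smul_one]

/-- The evaluation mapping `e : S → Δ`, `[e s](f) = f s`. -/
def evalChar (s : S) : F.Spectrum := CharacterSpace.equivAlgHom.symm (F.evalHom s)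

@[simp] lemma evalChar_apply (s : S) (f : F.alg) : F.evalChar s f = (f : S →ᵇ ℂ) s := rfl

/-- The left introversion operator `T_μ : F → F`, `(T_μ f)(s) = μ (L_s f)`. -/
def T (μ : F.Spectrum) (f : F.alg) : F.alg := (F.exists_introversion μ f).choose

lemma T_apply (μ : F.Spectrum) (f : F.alg) (s : S) : (F.T μ f : S →ᵇ ℂ) s = μ (F.L s f) :=
  (F.exists_introversion μ f).choose_spec s

lemma alg_ext {f g : F.alg} (h : ∀ s, (f : S →ᵇ ℂ) s = (g : S →ᵇ ℂ) s) : f = g :=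
  Subtype.ext (BoundedContinuousFunction.ext h)

/-- The homomorphism `f ↦ μ (T_ν f)`. -/
def mulHom (μ ν : F.Spectrum) : F.alg →ₐ[ℂ] ℂ :=
  (CharacterSpace.toAlgHom μ).comp
    { toFun := F.T ν
      map_one' := F.alg_ext fun s => by
        rw [T_apply, show F.L s 1 = 1 from rfl, map_one]; rfl
      map_mul' := fun f g => F.alg_ext fun s => by
        rw [T_apply, show F.L s (f * g) = F.L s f * F.L s g from rfl, map_mul,
          ← T_apply, ← T_apply]; rfl
      map_zero' := F.alg_ext fun s => by
        rw [T_apply, show F.L s 0 = 0 from rfl, map_zero]; rfl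
      map_add' := fun f g => F.alg_ext fun s => by
        rw [T_apply, show F.L s (f + g) = F.L s f + F.L s g from rfl, map_add,
          ← T_apply, ← T_apply]; rfl
      commutes' := fun c => F.alg_ext fun s => by
        rw [T_apply, show F.L s (algebraMap ℂ F.alg c) = algebraMap ℂ F.alg c from rfl]
        rw [AlgHomClass.commutes]
        simp [Algebra.algebraMap_eq_smul_one] }

/-- The semigroup operation of the spectrum: `(μ ν)(f) = μ (T_ν f)`. -/
instance : Mul F.Spectrum := ⟨fun μ ν => CharacterSpace.equivAlgHom.symm (F.mulHom μ ν)⟩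

lemma spectrum_mul_apply (μ ν : F.Spectrum) (f : F.alg) : (μ * ν) f = μ (F.T ν f) := rfl

/-- The topology `τ(F)` on `S`: the weak topology generated by the members of `F`. -/
@[reducible] def tau : TopologicalSpace S :=
  ⨅ f : F.alg, TopologicalSpace.induced (fun s => (f : S →ᵇ ℂ) s) inferInstance

/-- An `F`-filter on `S`: a (proper) filter `φ` such that for every `A ∈ φ` with `A ≠ S` there are
`B ∈ φ` and `f ∈ F` with `f = 0` on `B` and `f = 1` on `S \ A`. -/
structure IsFFilter (φ : Filter S) : Prop where
  neBot : φ.NeBot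
  exists_separating : ∀ A ∈ φ, A ≠ univ → ∃ B ∈ φ, ∃ f ∈ F.alg,
    (∀ s ∈ B, f s = 0) ∧ ∀ s ∉ A, f s = 1

/-- An `F`-ultrafilter: an `F`-filter that is maximal among the `F`-filters with respect to
inclusion of families of sets. -/
def IsFUltrafilter (p : Filter S) : Prop :=
  F.IsFFilter p ∧ ∀ ψ : Filter S, F.IsFFilter ψ → (∀ A ∈ p, A ∈ ψ) → ψ = p

/-- `δS`, the set of all `F`-ultrafilters on `S`. -/
def DeltaS : Type _ := {p : Filter S // F.IsFUltrafilter p}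

/-- `S(f, r) = {s : |f s| ≤ r}`. -/
def sublevel (f : F.alg) (r : ℝ) : Set S := {s | ‖(f : S →ᵇ ℂ) s‖ ≤ r}

/-- The filter on `S` generated by `B(I) = {S(f, r) : f ∈ I, r > 0}`. -/
def idealFilter (I : Ideal F.alg) : Filter S :=
  Filter.generate {A | ∃ f ∈ I, ∃ r : ℝ, 0 < r ∧ A = F.sublevel f r}

/-- The set `{p ∈ δS : A ∈ p}`. -/
def hat (A : Set S) : Set F.DeltaS := {p | A ∈ p.1}

/-- The topology of `δS`, with base the sets `hat A`, `A ⊆ S`. -/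
instance : TopologicalSpace F.DeltaS :=
  TopologicalSpace.generateFrom {U | ∃ A : Set S, U = F.hat A}

lemma idealFilter_eq (I : Ideal F.alg) :
    F.idealFilter I = ⨅ f ∈ I, comap (fun s => (f : S →ᵇ ℂ) s) (𝓝 0) := by
  apply le_antisymm
  · refine le_iInf₂ fun f hf => ?_
    rw [(Metric.nhds_basis_closedBall (x := (0 : ℂ))).comap _ |>.ge_iff]
    intro r hr
    refine Filter.mem_generate_of_mem ⟨f, hf, r, hr, ?_⟩
    ext s; simp [sublevel]
  · refine Filter.le_generate_iff.2 ?_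
    rintro _ ⟨f, hf, r, hr, rfl⟩
    refine Filter.mem_iInf_of_mem f (Filter.mem_iInf_of_mem hf ?_)
    refine ⟨Metric.closedBall 0 r, Metric.closedBall_mem_nhds _ hr, ?_⟩
    intro s hs; simpa [sublevel] using hs

lemma nhds_spectrum (μ : F.Spectrum) :
    𝓝 μ = ⨅ f : F.alg, comap (fun ν : F.Spectrum => ν f) (𝓝 (μ f)) := by
  rw [nhds_induced]
  have h : 𝓝 (μ : WeakDual ℂ F.alg) =
      comap (fun (ν : WeakDual ℂ F.alg) (f : F.alg) => ν f) (𝓝 fun f => μ f) :=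
    nhds_induced _ _
  rw [h, nhds_pi, Filter.pi, comap_iInf, comap_iInf]
  simp only [comap_comap]
  rfl

/-- The filter generated by `B(ker μ)` is the trace on `S` of the neighbourhoods of `μ`. -/
lemma idealFilter_ker (μ : F.Spectrum) :
    F.idealFilter (RingHom.ker μ) = comap F.evalChar (𝓝 μ) := by
  rw [idealFilter_eq, nhds_spectrum, comap_iInf]
  simp only [comap_comap]
  apply le_antisymm
  · refine le_iInf fun f => ?_
    refine (iInf₂_le (f - algebraMap ℂ F.alg (μ f)) ?_).trans ?_
    · rw [RingHom.mem_ker, map_sub, AlgHomClass.commutes]; simp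
    · rw [← tendsto_iff_comap]
      have h : Tendsto (fun s : S => ((f - algebraMap ℂ F.alg (μ f) : F.alg) : S →ᵇ ℂ) s + μ f)
          (comap (fun s : S => ((f - algebraMap ℂ F.alg (μ f) : F.alg) : S →ᵇ ℂ) s) (𝓝 0))
          (𝓝 (0 + μ f)) := tendsto_comap.add tendsto_const_nhds
      rw [zero_add] at h
      refine h.congr fun s => ?_
      simp [Algebra.algebraMap_eq_smul_one]
  · refine le_iInf₂ fun f hf => (iInf_le _ f).trans ?_
    rw [RingHom.mem_ker] at hf
    rw [hf]; rfl

lemma exists_of_continuous (h : C(F.Spectrum, ℂ)) : ∃ f : F.alg, ∀ μ : F.Spectrum, μ f = h μ := by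
  obtain ⟨f, hf⟩ := (gelfandTransform_bijective F.alg).2 h
  exact ⟨f, fun μ => congrArg (fun k : C(F.Spectrum, ℂ) => k μ) hf⟩

lemma exists_urysohn {K L : Set F.Spectrum} (hK : IsClosed K) (hL : IsClosed L)
    (hd : Disjoint K L) : ∃ f : F.alg, (∀ μ ∈ K, μ f = 0) ∧ ∀ μ ∈ L, μ f = 1 := by
  obtain ⟨g, h0, h1, -⟩ := exists_continuous_zero_one_of_isClosed hK hL hd
  obtain ⟨f, hf⟩ := F.exists_of_continuous
    ⟨fun μ => (g μ : ℂ), Complex.continuous_ofReal.comp g.continuous⟩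
  refine ⟨f, fun μ hμ => ?_, fun μ hμ => ?_⟩
  · simp [hf, h0 hμ]
  · simp [hf, h1 hμ]

lemma denseRange_evalChar : DenseRange F.evalChar := by
  intro μ
  by_contra hμ
  obtain ⟨f, h0, h1⟩ := F.exists_urysohn isClosed_closure isClosed_singleton
    (disjoint_singleton_right.2 hμ)
  have hf : f = 0 := F.alg_ext fun s => h0 _ (subset_closure ⟨s, rfl⟩)
  have := h1 μ rfl
  rw [hf, map_zero] at this
  exact zero_ne_one this

lemma isFFilter_ker (μ : F.Spectrum) : F.IsFFilter (F.idealFilter (RingHom.ker μ)) := by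
  rw [idealFilter_ker]
  refine ⟨?_, fun A hA _ => ?_⟩
  · rw [comap_neBot_iff]
    intro U hU
    obtain ⟨_, h, s, rfl⟩ := mem_closure_iff_nhds.1 (F.denseRange_evalChar μ) U hU
    exact ⟨s, h⟩
  obtain ⟨U, hU, hUA⟩ := hA
  obtain ⟨K, hK, hKc, hKU⟩ := exists_mem_nhds_isClosed_subset (interior_mem_nhds.2 hU)
  obtain ⟨f, h0, h1⟩ := F.exists_urysohn hKc isOpen_interior.isClosed_compl
    (disjoint_compl_right_iff_subset.2 hKU)
  refine ⟨F.evalChar ⁻¹' K, preimage_mem_comap hK, f, f.2, fun s hs => h0 _ hs, fun s hs => ?_⟩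
  exact h1 (F.evalChar s) fun h => hs (hUA (mem_preimage.2 (interior_subset h)))

/-- Every `F`-filter is contained in the filter generated by `B(ker μ)` for some `μ`. -/
lemma IsFFilter.exists_le {φ : Filter S} (hφ : F.IsFFilter φ) :
    ∃ μ : F.Spectrum, F.idealFilter (RingHom.ker μ) ≤ φ := by
  have := hφ.neBot
  obtain ⟨μ, hμ⟩ := exists_clusterPt_of_compactSpace (map F.evalChar φ)
  refine ⟨μ, fun A hA => ?_⟩
  by_cases hAu : A = univ
  · rw [hAu]; exact univ_mem
  obtain ⟨B, hB, f, hf, h0, h1⟩ := hφ.exists_separating A hA hAu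
  have hcont : Continuous fun ν : F.Spectrum => ν (⟨f, hf⟩ : F.alg) :=
    (gelfandTransform ℂ F.alg ⟨f, hf⟩).continuous
  have hzero : μ (⟨f, hf⟩ : F.alg) = 0 := by
    have hmem : μ ∈ closure (F.evalChar '' B) :=
      clusterPt_iff_forall_mem_closure.1 hμ _ (image_mem_map hB)
    have hcl : IsClosed {ν : F.Spectrum | ν (⟨f, hf⟩ : F.alg) = 0} :=
      isClosed_eq hcont continuous_const
    refine closure_minimal ?_ hcl hmem
    rintro _ ⟨s, hs, rfl⟩
    exact h0 s hs
  refine mem_of_superset (Filter.mem_generate_of_mem ⟨⟨f, hf⟩, hzero, 1 / 2, by norm_num, rfl⟩) ?_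
  intro s hs
  by_contra hsA
  have : ‖f s‖ ≤ 1 / 2 := hs
  rw [h1 s hsA] at this
  norm_num at this

lemma eq_of_idealFilter_ker_le {μ ν : F.Spectrum}
    (h : F.idealFilter (RingHom.ker μ) ≤ F.idealFilter (RingHom.ker ν)) : μ = ν := by
  have := (F.isFFilter_ker μ).neBot
  have hμ : Tendsto F.evalChar (F.idealFilter (RingHom.ker μ)) (𝓝 μ) := by
    rw [idealFilter_ker]; exact tendsto_comap
  have hν : Tendsto F.evalChar (F.idealFilter (RingHom.ker ν)) (𝓝 ν) := by
    rw [idealFilter_ker]; exact tendsto_comap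
  exact tendsto_nhds_unique hμ (hν.mono_left h)

lemma isFUltrafilter_ker (μ : F.Spectrum) : F.IsFUltrafilter (F.idealFilter (RingHom.ker μ)) := by
  refine ⟨F.isFFilter_ker μ, fun ψ hψ h => ?_⟩
  obtain ⟨ν, hν⟩ := hψ.exists_le
  have hψμ : ψ ≤ F.idealFilter (RingHom.ker μ) := h
  obtain rfl := F.eq_of_idealFilter_ker_le (hν.trans hψμ)
  exact le_antisymm hψμ hν

/-- The mapping `μ ↦ p(μ)` from `Δ` to `δS`: `p(μ)` is the `F`-ultrafilter generated by
`B(ker μ)`. -/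
def toDelta (μ : F.Spectrum) : F.DeltaS := ⟨F.idealFilter (RingHom.ker μ), F.isFUltrafilter_ker μ⟩

lemma toDelta_bijective : Function.Bijective F.toDelta := by
  refine ⟨fun μ ν h => F.eq_of_idealFilter_ker_le (congrArg Subtype.val h).le, fun p => ?_⟩
  obtain ⟨μ, hμ⟩ := p.2.1.exists_le
  exact ⟨μ, Subtype.ext (p.2.2 _ (F.isFFilter_ker μ) hμ)⟩

/-- The bijection `μ ↦ p(μ)` from `Δ` onto `δS`. -/
def deltaEquiv : F.Spectrum ≃ F.DeltaS := Equiv.ofBijective F.toDelta F.toDelta_bijective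

/-- The semigroup operation of `δS`, the one of `Δ` transported along `μ ↦ p(μ)`:
`p(μ) p(ν) = p(μ ν)`. -/
instance : Mul F.DeltaS := ⟨fun p q => F.deltaEquiv (F.deltaEquiv.symm p * F.deltaEquiv.symm q)⟩

lemma toDelta_mul (μ ν : F.Spectrum) : F.toDelta μ * F.toDelta ν = F.toDelta (μ * ν) := by
  change F.deltaEquiv (F.deltaEquiv.symm (F.deltaEquiv μ) * F.deltaEquiv.symm (F.deltaEquiv ν)) = _
  rw [Equiv.symm_apply_apply, Equiv.symm_apply_apply]
  rfl

/-- The `τ(F)`-neighbourhoods of `s` form the filter generated by `B(ker (e s))`. -/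
lemma nhds_tau (s : S) : @nhds S F.tau s = F.idealFilter (RingHom.ker (F.evalChar s)) := by
  rw [idealFilter_ker, nhds_spectrum, comap_iInf, tau, nhds_iInf]
  simp only [nhds_induced, comap_comap]
  rfl

/-- The canonical mapping `ε : S → δS`, which sends `s` to the family of its
`τ(F)`-neighbourhoods. -/
def eps (s : S) : F.DeltaS :=
  ⟨@nhds S F.tau s, by rw [nhds_tau]; exact F.isFUltrafilter_ker _⟩

/-- The closed subset `⋂_{A ∈ φ} closure (ε(A))` of `δS` determined by an `F`-filter `φ`. -/
def closureOf (φ : Filter S) : Set F.DeltaS := ⋂ A ∈ φ, closure (F.eps '' A)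

/-- An ideal `I` of `F` is right translation invariant if `R_s f ∈ I` for all `f ∈ I`, `s ∈ S`. -/
def IsRightTranslationInvariant (I : Ideal F.alg) : Prop := ∀ f ∈ I, ∀ s : S, F.R s f ∈ I

end MAdmissibleSubalgebra

/-- A filter `φ` on `S` is right thick if for all `A ∈ φ` and `s ∈ S` there is `B ∈ φ` with
`B s ⊆ A`. -/
def IsRightThick (φ : Filter S) : Prop :=
  ∀ A ∈ φ, ∀ s : S, ∃ B ∈ φ, (fun t => t * s) '' B ⊆ A

/-- A right ideal of `T`: a non-empty subset `J` with `J T ⊆ J`. -/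
def IsRightIdeal {T : Type*} [Mul T] (J : Set T) : Prop :=
  J.Nonempty ∧ ∀ p ∈ J, ∀ q : T, p * q ∈ J

end FilterCompactification

end

namespace FilterCompactification.MAdmissibleSubalgebra

open Set Filter Topology WeakDual
open scoped BoundedContinuousFunction

/-! Under `toDelta`, the set `closureOf φ` is the hull of `I`, the set of `μ` vanishing on `I`
(`toDelta_mem_closureOf_iff`), and by Gelfand duality a closed ideal is recovered from its hull
(`mem_of_forall_le_ker`). So (1) amounts to `T_ν I ⊆ I` for all `ν ∈ Δ`, while (2) is the same
condition for point evaluations only, because `T_{e(s)} = R_s` (`T_evalChar`).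

The passage from (2) back to (1) is where weak almost periodicity enters: `T_ν f` is always a
pointwise limit of right translates of `f`, and weak compactness of the orbit closure makes it a
weak limit (`T_mem_weak_closure`). A norm closed subspace is weakly closed, so `T_ν f` stays in `I`.

For (3), `φ` is the coarsest filter along which every `f ∈ I` tends to `0`, and thickness says that
each right multiplication maps `φ` to `φ`; both directions then reduce to `R_s f → 0` along `φ`. -/

lemma continuous_weakSpace_apply {X : Type*} [TopologicalSpace X] (t : X) :
    Continuous fun g : WeakSpace ℂ (X →ᵇ ℂ) => (toWeakSpace ℂ (X →ᵇ ℂ)).symm g t :=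
  WeakBilin.eval_continuous (topDualPairing ℂ (X →ᵇ ℂ)).flip
    (BoundedContinuousFunction.evalCLM ℂ t)

lemma isRightThick_iff_tendsto {X : Type*} [Semigroup X] {φ : Filter X} :
    IsRightThick φ ↔ ∀ s : X, Tendsto (fun t => t * s) φ φ := by
  refine ⟨fun h s A hA => ?_, fun h A hA s => ⟨_, h s hA, image_preimage_subset _ _⟩⟩
  obtain ⟨B, hB, hBA⟩ := h A hA s
  exact mem_map.2 (mem_of_superset hB (image_subset_iff.1 hBA))

variable {S : Type*} [Semigroup S] [TopologicalSpace S] [SeparatelyContinuousMul S]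
  (F : MAdmissibleSubalgebra S)

lemma continuous_spectrum_apply (f : F.alg) : Continuous fun μ : F.Spectrum => μ f :=
  (gelfandTransform ℂ F.alg f).continuous

/-- A closed ideal of `F` is the intersection of the kernels that contain it. -/
lemma mem_of_forall_le_ker {I : Ideal F.alg} (hI : IsClosed (I : Set F.alg)) {f : F.alg}
    (hf : ∀ μ : F.Spectrum, I ≤ RingHom.ker μ → μ f = 0) : f ∈ I := by
  let e := gelfandStarTransform F.alg
  have he : ∀ (g : F.alg) (μ : F.Spectrum), e g μ = μ g := fun _ _ => rfl
  let J : Ideal C(F.Spectrum, ℂ) := I.comap (e.symm : C(F.Spectrum, ℂ) →+* F.alg)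
  have hJ_mem : ∀ g, g ∈ J ↔ e.symm g ∈ I := fun g => Iff.rfl
  have hJ_closed : IsClosed (J : Set C(F.Spectrum, ℂ)) := by
    have himage : (J : Set C(F.Spectrum, ℂ)) = gelfandTransform ℂ F.alg '' I := by
      ext g
      refine ⟨fun hg => ⟨e.symm g, hg, e.apply_symm_apply g⟩, ?_⟩
      rintro ⟨k, hk, rfl⟩
      change e.symm (e k) ∈ I
      rwa [e.symm_apply_apply]
    rw [himage]
    exact (gelfandTransform_isometry F.alg).isClosedEmbedding.isClosedMap _ hI
  -- The complement of `setOfIdeal J` is the common zero set of `J`, which is the hull of `I`.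
  have hmem : e f ∈ ContinuousMap.idealOfSet ℂ (ContinuousMap.setOfIdeal J) := by
    rw [ContinuousMap.mem_idealOfSet]
    intro μ hμ
    rw [he]
    refine hf μ fun g hg => ?_
    rw [mem_compl_iff, ContinuousMap.notMem_setOfIdeal] at hμ
    exact hμ (f := e g) (by rwa [hJ_mem, e.symm_apply_apply])
  rw [ContinuousMap.idealOfSet_ofIdeal_isClosed hJ_closed, hJ_mem, e.symm_apply_apply] at hmem
  exact hmem

/-! ### Closures in `δS` and hulls in the spectrum -/

lemma isOpen_preimage_hat (A : Set S) : IsOpen (F.toDelta ⁻¹' F.hat A) := by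
  have h : F.toDelta ⁻¹' F.hat A = {μ | ∀ᶠ ν in 𝓝 μ, ∀ s, F.evalChar s = ν → s ∈ A} := by
    ext μ
    change A ∈ F.idealFilter (RingHom.ker μ) ↔ _
    rw [idealFilter_ker, mem_comap']
    rfl
  rw [h]
  exact isOpen_setOfPred_eventually_nhds

lemma continuous_toDelta : Continuous F.toDelta :=
  continuous_generateFrom_iff.2 <| by
    rintro _ ⟨A, rfl⟩
    exact F.isOpen_preimage_hat A

lemma eps_eq_toDelta (s : S) : F.eps s = F.toDelta (F.evalChar s) :=
  Subtype.ext (F.nhds_tau s)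

lemma mem_closure_image_of_mem {A : Set S} {μ : F.Spectrum}
    (hA : A ∈ F.idealFilter (RingHom.ker μ)) : μ ∈ closure (F.evalChar '' A) := by
  have := (F.isFFilter_ker μ).neBot
  have h : Tendsto F.evalChar (F.idealFilter (RingHom.ker μ)) (𝓝 μ) := by
    rw [idealFilter_ker]; exact tendsto_comap
  exact mem_closure_of_tendsto h (mem_of_superset hA fun s hs => mem_image_of_mem _ hs)

/-- One direction is continuity of `toDelta`. For the other, regularity of the spectrum supplies
closed neighbourhoods `K` of `μ`, and `hat (e⁻¹ K)` is a basic open set all of whose points come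
from `K`. -/
lemma toDelta_mem_closure_iff {A : Set S} {μ : F.Spectrum} :
    F.toDelta μ ∈ closure (F.eps '' A) ↔ μ ∈ closure (F.evalChar '' A) := by
  have himage : F.eps '' A = F.toDelta '' (F.evalChar '' A) := by
    rw [image_image]
    exact image_congr fun s _ => F.eps_eq_toDelta s
  rw [himage]
  refine ⟨fun h => ?_, fun h => image_closure_subset_closure_image F.continuous_toDelta
    (mem_image_of_mem _ h)⟩
  rw [mem_closure_iff_nhds]
  intro U hU
  obtain ⟨K, hK, hKc, hKU⟩ := exists_mem_nhds_isClosed_subset hU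
  have hopen : IsOpen (F.hat (F.evalChar ⁻¹' K)) :=
    TopologicalSpace.isOpen_generateFrom_of_mem ⟨_, rfl⟩
  have hmem : F.toDelta μ ∈ F.hat (F.evalChar ⁻¹' K) := by
    change F.evalChar ⁻¹' K ∈ F.idealFilter (RingHom.ker μ)
    rw [idealFilter_ker]
    exact preimage_mem_comap hK
  obtain ⟨_, hν, ν, hνA, rfl⟩ := mem_closure_iff.1 h _ hopen hmem
  refine ⟨ν, hKU ?_, hνA⟩
  exact closure_minimal (image_preimage_subset _ _) hKc (F.mem_closure_image_of_mem hν)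

lemma idealFilter_anti {I J : Ideal F.alg} (h : I ≤ J) : F.idealFilter J ≤ F.idealFilter I := by
  rw [idealFilter_eq, idealFilter_eq]
  exact biInf_mono h

/-- The closed set determined by the filter of `I` is the hull of `I`. -/
lemma toDelta_mem_closureOf_iff {I : Ideal F.alg} {μ : F.Spectrum} :
    F.toDelta μ ∈ F.closureOf (F.idealFilter I) ↔ I ≤ RingHom.ker μ := by
  simp only [closureOf, mem_iInter, toDelta_mem_closure_iff]
  refine ⟨fun h f hf => ?_, fun h A hA => F.mem_closure_image_of_mem (F.idealFilter_anti h hA)⟩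
  rw [RingHom.mem_ker, ← norm_le_zero_iff]
  refine le_of_forall_pos_le_add fun r hr => ?_
  rw [zero_add]
  have hcl : IsClosed {ν : F.Spectrum | ‖ν f‖ ≤ r} :=
    isClosed_le (F.continuous_spectrum_apply f).norm continuous_const
  refine closure_minimal ?_ hcl
    (h (F.sublevel f r) (Filter.mem_generate_of_mem ⟨f, hf, r, hr, rfl⟩))
  rintro _ ⟨s, hs, rfl⟩
  exact hs

/-! ### Introversion operators and weak almost periodicity -/

lemma tendsto_apply_ker (μ : F.Spectrum) (f : F.alg) :
    Tendsto (fun s => (f : S →ᵇ ℂ) s) (F.idealFilter (RingHom.ker μ)) (𝓝 (μ f)) := by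
  rw [idealFilter_ker]
  exact ((F.continuous_spectrum_apply f).tendsto μ).comp tendsto_comap

lemma T_evalChar (s : S) (f : F.alg) : F.T (F.evalChar s) f = F.R s f :=
  F.alg_ext fun t => F.T_apply _ f t

/-- For a weakly almost periodic `f`, the function `T_ν f` lies in the weak closure of the right
orbit of `f`. -/
lemma T_mem_weak_closure (ν : F.Spectrum) {f : F.alg} (hf : (f : S →ᵇ ℂ) ∈ WAP S) :
    toWeakSpace ℂ (S →ᵇ ℂ) (F.T ν f) ∈
      closure (range fun s : S => toWeakSpace ℂ (S →ᵇ ℂ) (rightTranslate s f)) := by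
  have := (F.isFFilter_ker ν).neBot
  obtain ⟨g, hg, hclus⟩ : ∃ g ∈ closure (range fun s : S =>
      toWeakSpace ℂ (S →ᵇ ℂ) (rightTranslate s f)), MapClusterPt g
      (F.idealFilter (RingHom.ker ν)) fun s => toWeakSpace ℂ (S →ᵇ ℂ) (rightTranslate s f) :=
    hf (tendsto_principal.2 (Eventually.of_forall fun s => subset_closure ⟨s, rfl⟩))
  have heq : toWeakSpace ℂ (S →ᵇ ℂ) (F.T ν f) = g := by
    rw [← LinearEquiv.eq_symm_apply]
    refine BoundedContinuousFunction.ext fun t => ?_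
    rw [T_apply]
    -- Evaluation at `t` is weakly continuous and `(R_s f)(t) = (L_t f)(s)`, which converges to `ν
    -- (L_t f)`; hence the weak cluster point `g` has this value at `t`.
    have h1 : MapClusterPt ((toWeakSpace ℂ (S →ᵇ ℂ)).symm g t)
        (F.idealFilter (RingHom.ker ν)) fun s => (F.L t f : S →ᵇ ℂ) s :=
      hclus.continuousAt_comp (continuous_weakSpace_apply t).continuousAt
    have h2 : ClusterPt ((toWeakSpace ℂ (S →ᵇ ℂ)).symm g t) (𝓝 (ν (F.L t f))) :=
      ClusterPt.mono h1 (F.tendsto_apply_ker ν (F.L t f))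
    exact (eq_of_nhds_neBot h2).symm
  rwa [heq]

/-- A closed right translation invariant ideal of weakly almost periodic functions is invariant
under the introversion operators. -/
lemma IsRightTranslationInvariant.T_mem {I : Ideal F.alg} (hI : IsClosed (I : Set F.alg))
    (hinv : F.IsRightTranslationInvariant I) (ν : F.Spectrum) {f : F.alg} (hf : f ∈ I)
    (hWAP : (f : S →ᵇ ℂ) ∈ WAP S) : F.T ν f ∈ I := by
  -- `I` viewed inside `C(S)`, with real scalars so that it can serve as a convex set in Mazur's
  -- theorem.
  let V : Submodule ℝ (S →ᵇ ℂ) :=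
    (I.restrictScalars ℝ).map (F.alg.toSubalgebra.val.toLinearMap.restrictScalars ℝ)
  have hV : ∀ g : F.alg, (g : S →ᵇ ℂ) ∈ V ↔ g ∈ I := fun g =>
    ⟨by rintro ⟨k, hk, hkg⟩; exact Subtype.ext hkg ▸ hk, fun hg => ⟨g, hg, rfl⟩⟩
  have hV_closed : IsClosed (V : Set (S →ᵇ ℂ)) :=
    F.isClosed_alg.isClosedEmbedding_subtypeVal.isClosedMap _ hI
  have hweak : IsClosed (toWeakSpace ℂ (S →ᵇ ℂ) '' (V : Set (S →ᵇ ℂ))) := by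
    rw [← closure_eq_iff_isClosed, ← V.convex.toWeakSpace_closure ℂ, hV_closed.closure_eq]
  have hmem : toWeakSpace ℂ (S →ᵇ ℂ) (F.T ν f) ∈
      toWeakSpace ℂ (S →ᵇ ℂ) '' (V : Set (S →ᵇ ℂ)) := by
    refine closure_minimal ?_ hweak (F.T_mem_weak_closure ν hWAP)
    rintro _ ⟨s, rfl⟩
    exact ⟨_, (hV (F.R s f)).2 (hinv f hf s), rfl⟩
  obtain ⟨g, hg, hgT⟩ := hmem
  rw [(toWeakSpace ℂ (S →ᵇ ℂ)).injective hgT] at hg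
  exact (hV _).1 hg

/-! ### The implications between the three conditions -/

lemma tendsto_idealFilter {I : Ideal F.alg} {f : F.alg} (hf : f ∈ I) :
    Tendsto (fun s => (f : S →ᵇ ℂ) s) (F.idealFilter I) (𝓝 0) := by
  rw [idealFilter_eq, tendsto_iff_comap]
  exact iInf₂_le f hf

lemma IsRightTranslationInvariant.isRightThick {I : Ideal F.alg}
    (hinv : F.IsRightTranslationInvariant I) : IsRightThick (F.idealFilter I) := by
  refine isRightThick_iff_tendsto.2 fun s => ?_
  nth_rewrite 2 [idealFilter_eq]
  simp only [tendsto_iInf, tendsto_comap_iff]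
  exact fun f hf => F.tendsto_idealFilter (hinv f hf s)

lemma isRightTranslationInvariant_of_isRightThick {I : Ideal F.alg}
    (hI : IsClosed (I : Set F.alg)) (h : IsRightThick (F.idealFilter I)) :
    F.IsRightTranslationInvariant I := by
  intro f hf s
  refine F.mem_of_forall_le_ker hI fun μ hμ => ?_
  have := (F.isFFilter_ker μ).neBot
  have hzero : Tendsto (fun t => (F.R s f : S →ᵇ ℂ) t) (F.idealFilter I) (𝓝 0) :=
    (F.tendsto_idealFilter hf).comp (isRightThick_iff_tendsto.1 h s)
  -- The filter of a point `μ` of the hull is finer than that of `I`, so the limit `μ (R_s f)` must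
  -- be `0`.
  exact tendsto_nhds_unique (F.tendsto_apply_ker μ (F.R s f))
    (hzero.mono_left (F.idealFilter_anti hμ))

lemma isRightTranslationInvariant_of_isRightIdeal {I : Ideal F.alg}
    (hI : IsClosed (I : Set F.alg)) (h : IsRightIdeal (F.closureOf (F.idealFilter I))) :
    F.IsRightTranslationInvariant I := by
  intro f hf s
  refine F.mem_of_forall_le_ker hI fun μ hμ => ?_
  have hmul := h.2 _ (F.toDelta_mem_closureOf_iff.2 hμ) (F.toDelta (F.evalChar s))
  rw [toDelta_mul, toDelta_mem_closureOf_iff] at hmul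
  have hzero : (μ * F.evalChar s) f = 0 := hmul hf
  rwa [spectrum_mul_apply, T_evalChar] at hzero

/-- If the hull were empty, `1` would vacuously vanish on it and so lie in `I`. -/
lemma closureOf_idealFilter_nonempty {I : Ideal F.alg} (hI : IsClosed (I : Set F.alg))
    (hI_proper : I ≠ ⊤) : (F.closureOf (F.idealFilter I)).Nonempty := by
  by_contra hempty
  refine hI_proper ((Ideal.eq_top_iff_one I).2 (F.mem_of_forall_le_ker hI fun μ hμ => ?_))
  exact absurd ⟨_, F.toDelta_mem_closureOf_iff.2 hμ⟩ hempty

lemma IsRightTranslationInvariant.isRightIdeal {I : Ideal F.alg}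
    (hinv : F.IsRightTranslationInvariant I) (hI : IsClosed (I : Set F.alg)) (hI_proper : I ≠ ⊤)
    (hWAP : (F.alg : Set (S →ᵇ ℂ)) ⊆ WAP S) :
    IsRightIdeal (F.closureOf (F.idealFilter I)) := by
  refine ⟨F.closureOf_idealFilter_nonempty hI hI_proper, fun p hp q => ?_⟩
  obtain ⟨μ, rfl⟩ := F.toDelta_bijective.2 p
  obtain ⟨ν, rfl⟩ := F.toDelta_bijective.2 q
  rw [toDelta_mul, toDelta_mem_closureOf_iff]
  rw [toDelta_mem_closureOf_iff] at hp
  exact fun f hf => hp (IsRightTranslationInvariant.T_mem F hI hinv ν hf (hWAP f.2))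

end FilterCompactification.MAdmissibleSubalgebra

theorem mainTheorem10 {S : Type*} [Semigroup S] [TopologicalSpace S] [T2Space S]
    [SeparatelyContinuousMul S] (F : FilterCompactification.MAdmissibleSubalgebra S)
    (hWAP : (F.alg : Set (BoundedContinuousFunction S ℂ)) ⊆ FilterCompactification.WAP S)
    (φ : Filter S) (hφ : F.IsFFilter φ)
    (I : Ideal F.alg) (hI_closed : IsClosed (I : Set F.alg)) (hI_proper : I ≠ ⊤)
    (hφI : φ = F.idealFilter I) :
    List.TFAE [FilterCompactification.IsRightIdeal (F.closureOf φ),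
      F.IsRightTranslationInvariant I, FilterCompactification.IsRightThick φ] := by
  subst hφI
  tfae_have 1 → 2 := F.isRightTranslationInvariant_of_isRightIdeal hI_closed
  tfae_have 2 → 1 := fun h => h.isRightIdeal F hI_closed hI_proper hWAP
  tfae_have 2 → 3 := fun h => h.isRightThick F
  tfae_have 3 → 2 := F.isRightTranslationInvariant_of_isRightThick hI_closed
  tfae_finish
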